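/- Let $n\ge 1$, let $\Lambda\subset\mathbb Z^{2n+1}$ be a subgroup with $\operatorname{rank}\Lambda\le n-1$, and write its elements as $(a,b,c)$ with $a,b\in\mathbb Z^n$, $c\in\mathbb Z$. Let $V=V(\Lambda)\subset(\mathbb C\setminus\{0,1\})^n$ be the set of points satisfying $$\prod_{i=1}^n z_i^{a_i}\prod_{i=1}^n(1-z_i)^{b_i}=(-1)^c\qquad\text{for all }(a,b,c)\in\Lambda .$$ Let $\overline V$ be the closure of $V$ in $(\mathbb C\setminus\{1\})^n$ (here and below closures are taken in the usual topology); the points of $\overline V\setminus V$ are called ideal points. A *degeneration vector* is a nonzero $d\in(\mathbb Z_{\ge0})^n$ with $\sum_i a_id_i=0$ for all $(a,b,c)\in\Lambda$. It is *genuine* if there are an ideal point $p$ and a holomorphic map $f:D\to\overline V$ on the open unit disc $D\subset\mathbb C$ with $f(0)=p$, $f(D\setminus\{0\})\subset V$ and $f_i(t)=t^{d_i}u_i(t)$ for all $i$ and all $t\in D$, where each $u_i$ is holomorphic on $D$, $u_i(0)\neq0$ for all $i$, and $u_i(0)\ne1$ whenever $d_i=0$. Let $d$ be a degeneration vector, and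 let $j$ be an index with $d_j>0$ (after reordering the variables, $j=1$). Use coordinates $t$ and $u_i$ ($i\ne j$) on $\mathbb C^n$, with $t$ in the $j$-th place, and let $\pi:\mathbb C^n\to\mathbb C^n$ be the map with $\pi_j=t^{d_j}$ and $\pi_i=t^{d_i}u_i$ for $i\neq j$. Put $W(\Lambda,d)=\pi^{-1}(V)$, $$\overline U=\{\,u_i\ne0\text{ and }t^{d_i}u_i\neq1\text{ for all } i\ne j,\ t^{d_j}\ne1\,\}\subset\mathbb C^n,$$ let $\overline W(\Lambda,d)$ be the closure of $W(\Lambda,d)$ in $\overline U$, and let $\overline W_0(\Lambda,d)=\overline W(\Lambda,d)\cap\{t=0\}$. If $d$ is genuine, then $\overline W_0(\Lambda,d)$ is nonempty. Conversely, if $\overline W_0(\Lambda,d)$ is nonempty, then there is an integer $m>0$ such that $m\,d$ is genuine. -/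

import Mathlib

open Set Metric

namespace GluingVariety

/-- Exponent vectors `(a, b, c)`, i.e. elements of `ℤ^(2n+1) = ℤ^n × ℤ^n × ℤ`. -/
abbrev Exponent (n : ℕ) : Type := (Fin n → ℤ) × (Fin n → ℤ) × ℤ

/-- The space `(ℂ \ {0, 1})^n`. -/
def puncturedSpace (n : ℕ) : Set (Fin n → ℂ) := {z | ∀ i, z i ≠ 0 ∧ z i ≠ 1}

/-- The variety `V(Λ) ⊆ (ℂ \ {0, 1})^n`, cut out by
`∏ z_i ^ a_i * ∏ (1 - z_i) ^ b_i = (-1) ^ c` for all `(a, b, c) ∈ Λ`. -/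
def V {n : ℕ} (Λ : AddSubgroup (Exponent n)) : Set (Fin n → ℂ) :=
  {z | z ∈ puncturedSpace n ∧ ∀ a b : Fin n → ℤ, ∀ c : ℤ, (a, b, c) ∈ Λ →
    (∏ i, z i ^ a i) * (∏ i, (1 - z i) ^ b i) = (-1 : ℂ) ^ c}

/-- The closure of `V(Λ)` in `(ℂ \ {1})^n`. -/
def Vbar {n : ℕ} (Λ : AddSubgroup (Exponent n)) : Set (Fin n → ℂ) :=
  closure (V Λ) ∩ {z | ∀ i, z i ≠ 1}

/-- The ideal points of `V(Λ)`. -/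
def idealPoints {n : ℕ} (Λ : AddSubgroup (Exponent n)) : Set (Fin n → ℂ) :=
  Vbar Λ \ V Λ

/-- A degeneration vector: a nonzero vector of nonnegative integers in the kernel of the matrix `A`
whose rows are the `a`-parts of (a basis of) `Λ`. -/
def IsDegenerationVector {n : ℕ} (Λ : AddSubgroup (Exponent n)) (d : Fin n → ℕ) : Prop :=
  d ≠ 0 ∧ ∀ a b : Fin n → ℤ, ∀ c : ℤ, (a, b, c) ∈ Λ → ∑ i, a i * (d i : ℤ) = 0

/-- A degeneration vector `d` is genuine if there are an ideal point `p` and a holomorphic map `f`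
from the open unit disc to `Vbar Λ`, with `f 0 = p` and with values in `V Λ` away from `0`, of the
form `f_i(t) = t ^ d_i * u_i(t)`, where every `u_i` is holomorphic on the disc, `u_i(0) ≠ 0` for
all `i`, and `u_i(0) ≠ 1` when `d_i = 0`. -/
def IsGenuine {n : ℕ} (Λ : AddSubgroup (Exponent n)) (d : Fin n → ℕ) : Prop :=
  IsDegenerationVector Λ d ∧
  ∃ p ∈ idealPoints Λ, ∃ f : ℂ → Fin n → ℂ, ∃ u : Fin n → ℂ → ℂ,
    DifferentiableOn ℂ f (ball 0 1) ∧
    MapsTo f (ball 0 1) (Vbar Λ) ∧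
    f 0 = p ∧
    (∀ t ∈ ball (0 : ℂ) 1, t ≠ 0 → f t ∈ V Λ) ∧
    (∀ i, DifferentiableOn ℂ (u i) (ball 0 1)) ∧
    (∀ i, u i 0 ≠ 0) ∧
    (∀ i, d i = 0 → u i 0 ≠ 1) ∧
    ∀ t ∈ ball (0 : ℂ) 1, ∀ i, f t i = t ^ d i * u i t

/-- The map `π : ℂ^n → ℂ^n`. The coordinate `x j` of the source is called `t`, and the coordinates
`x i` with `i ≠ j` are called `u_i`; then `π(x)_j = t ^ d_j` and `π(x)_i = t ^ d_i * u_i` for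
`i ≠ j`. For `j` the first index, `π(t, u_2, …, u_n) = (t ^ d_1, t ^ d_2 u_2, …, t ^ d_n u_n)`. -/
def piMap {n : ℕ} (d : Fin n → ℕ) (j : Fin n) (x : Fin n → ℂ) : Fin n → ℂ :=
  fun i => if i = j then x j ^ d j else x j ^ d i * x i

/-- `W(Λ, d)`, the preimage of `V(Λ)` under `π`. -/
def W {n : ℕ} (Λ : AddSubgroup (Exponent n)) (d : Fin n → ℕ) (j : Fin n) : Set (Fin n → ℂ) :=
  piMap d j ⁻¹' V Λ

/-- The partial compactification of `U = π⁻¹((ℂ \ {0, 1})^n)` in which `t` may be zero: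
all `u_i` are nonzero, `t ^ d_j ≠ 1`, and `t ^ d_i * u_i ≠ 1` for `i ≠ j`. -/
def Ubar {n : ℕ} (d : Fin n → ℕ) (j : Fin n) : Set (Fin n → ℂ) :=
  {x | (∀ i, i ≠ j → x i ≠ 0) ∧ ∀ i, piMap d j x i ≠ 1}

/-- The closure of `W(Λ, d)` in `Ubar`. -/
def Wbar {n : ℕ} (Λ : AddSubgroup (Exponent n)) (d : Fin n → ℕ) (j : Fin n) : Set (Fin n → ℂ) :=
  closure (W Λ d j) ∩ Ubar d j

/-- The part of `Wbar` lying over `t = 0`. -/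
def Wbar0 {n : ℕ} (Λ : AddSubgroup (Exponent n)) (d : Fin n → ℕ) (j : Fin n) :
    Set (Fin n → ℂ) :=
  Wbar Λ d j ∩ {x | x j = 0}

end GluingVariety

namespace GluingVariety

open PowerSeries Filter Topology

/-! Both implications compare analytic curves in `V` through an ideal point with limit points of `W`
on t = 0.

If f_i = z^{d_i} u_i realises d, take a root v of u_j with v^{d_j} = u_j, continuous at 0. In the
parameter t = z v, the curve has j-th coordinate t^{d_j} and other coordinates t^{d_i} (u_i /
v^{d_i}). It therefore lifts through π, and the lift at z = 0 is a point of `Wbar0`.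

Conversely, a point of `Wbar0` is merely a limit of points of `W`. Curve selection
(`exists_analytic_curve`) provides an analytic curve through it, in the Zariski closure of `W`, with
t not identically zero. If t vanishes along it to order m, then the i-th coordinate of its image
under π has order m d_i; this is where the multiple m d comes from.

Curve selection is reduced to algebra. Noether normalization and going down cut a component of the
Zariski closure down to a curve; a point of its normalization gives a discrete valuation ring, and
expansion in a uniformizer gives power series algebraic over polynomials
(`exists_algHom_powerSeries_map_ne_zero`). Such series converge
(`exists_taylorHom_eq_of_isAlgebraic`), by a Newton-type substitution and the implicit function
theorem. -/

/-! ### Taylor expansion of analytic germs -/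

/-- The algebra of complex functions that are analytic at the origin. -/
def analyticAtZero : Subalgebra ℂ (ℂ → ℂ) where
  carrier := {F | AnalyticAt ℂ F 0}
  mul_mem' hF hG := AnalyticAt.mul hF hG
  add_mem' hF hG := AnalyticAt.add hF hG
  algebraMap_mem' _ := analyticAt_const

/-- The Taylor expansion at the origin. -/
noncomputable def taylorHom : analyticAtZero →ₐ[ℂ] ℂ⟦X⟧ where
  toFun F := PowerSeries.mk fun k => (k.factorial : ℂ)⁻¹ * iteratedDeriv k F.1 0
  map_one' := by
    ext k
    have : ((1 : analyticAtZero) : ℂ → ℂ) = fun _ => 1 := rfl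
    simp only [coeff_mk, this, iteratedDeriv_const, coeff_one]
    split_ifs with h <;> simp [h]
  map_zero' := by
    ext k
    simp
  map_add' F G := by
    ext k
    have : ((F + G : analyticAtZero) : ℂ → ℂ) = F.1 + G.1 := rfl
    have hF : AnalyticAt ℂ F.1 0 := F.2
    have hG : AnalyticAt ℂ G.1 0 := G.2
    simp [this, iteratedDeriv_add hF.contDiffAt hG.contDiffAt, mul_add]
  map_mul' F G := by
    ext k
    have : ((F * G : analyticAtZero) : ℂ → ℂ) = F.1 * G.1 := rfl
    have hF : AnalyticAt ℂ F.1 0 := F.2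
    have hG : AnalyticAt ℂ G.1 0 := G.2
    simp only [coeff_mk, this, iteratedDeriv_mul hF.contDiffAt hG.contDiffAt, Finset.mul_sum,
      PowerSeries.coeff_mul, Finset.Nat.sum_antidiagonal_eq_sum_range_succ_mk, Nat.succ_eq_add_one]
    refine Finset.sum_congr rfl fun i hi => ?_
    rw [Nat.cast_choose _ (by grind)]
    field_simp [Nat.factorial_ne_zero]
  commutes' r := by
    ext k
    have : ((algebraMap ℂ analyticAtZero r : analyticAtZero) : ℂ → ℂ) = fun _ => r := rfl
    simp only [coeff_mk, this, iteratedDeriv_const, PowerSeries.algebraMap_apply,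
      Algebra.algebraMap_self, RingHom.id_apply, coeff_C]
    split_ifs with h <;> simp [h]

theorem coeff_taylorHom (F : analyticAtZero) (k : ℕ) :
    coeff k (taylorHom F) = (k.factorial : ℂ)⁻¹ * iteratedDeriv k F.1 0 := by
  change coeff k (PowerSeries.mk fun k => (k.factorial : ℂ)⁻¹ * iteratedDeriv k F.1 0) = _
  rw [coeff_mk]

theorem constantCoeff_taylorHom (F : analyticAtZero) :
    constantCoeff (taylorHom F) = F.1 0 := by
  simp [← coeff_zero_eq_constantCoeff_apply, coeff_taylorHom]

theorem eventually_eq_zero_of_taylorHom_eq_zero {F : analyticAtZero} (h : taylorHom F = 0) :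
    ∀ᶠ z in 𝓝 (0 : ℂ), F.1 z = 0 := by
  have hF : AnalyticAt ℂ F.1 0 := F.2
  have h0 : ∀ k, iteratedDeriv k F.1 0 = 0 := fun k => by
    have := congrArg (coeff k) h
    simpa [coeff_taylorHom, Nat.factorial_ne_zero] using this
  have := hF.hasFPowerSeriesAt
  simp only [h0] at this
  have h2 : (FormalMultilinearSeries.ofScalars ℂ fun k : ℕ => (0 : ℂ) / k.factorial) = 0 := by
    ext; simp [FormalMultilinearSeries.ofScalars]
  rw [h2] at this
  exact this.eventually_eq_zero

/-- The coordinate function of `ℂ`. -/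
def coordinate : analyticAtZero := ⟨fun z => z, analyticAt_id⟩

theorem taylorHom_coordinate : taylorHom coordinate = X := by
  ext k
  have : (coordinate : ℂ → ℂ) = id := rfl
  rw [coeff_taylorHom, this, coeff_X]
  rcases k with _ | _ | k
  · simp
  · simp
  · have : iteratedDeriv (k + 1 + 1) (id : ℂ → ℂ) = fun _ => 0 := by
      rw [iteratedDeriv_succ', show deriv (id : ℂ → ℂ) = fun _ => 1 from funext fun _ => by simp]
      ext; simp [iteratedDeriv_const]
    simp [this]

theorem taylorHom_eq_zero_of_eventually {F : analyticAtZero} (h : ∀ᶠ z in 𝓝 (0 : ℂ), F.1 z = 0) :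
    taylorHom F = 0 := by
  have h' : F.1 =ᶠ[𝓝 0] fun _ => (0 : ℂ) := h
  ext k
  rw [coeff_taylorHom, h'.iteratedDeriv_eq]
  simp

/-! ### Convergence of algebraic power series -/

/-- Polynomials as functions analytic at the origin. -/
noncomputable def polynomialGerm : Polynomial ℂ →ₐ[ℂ] analyticAtZero := Polynomial.aeval coordinate

theorem polynomialGerm_apply (p : Polynomial ℂ) (z : ℂ) : (polynomialGerm p).1 z = p.eval z := by
  have : ((Pi.evalAlgHom ℂ (fun _ : ℂ => ℂ) z).comp analyticAtZero.val).comp polynomialGerm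
      = Polynomial.aeval z := by
    ext; simp [polynomialGerm, coordinate]
  simpa [Polynomial.aeval_def] using DFunLike.congr_fun this p

theorem taylorHom_polynomialGerm (p : Polynomial ℂ) :
    taylorHom (polynomialGerm p) = algebraMap (Polynomial ℂ) ℂ⟦X⟧ p := by
  have : taylorHom.comp polynomialGerm = Algebra.algHom ℂ (Polynomial ℂ) ℂ⟦X⟧ := by
    ext; simp [polynomialGerm, taylorHom_coordinate, algebraMap_apply', Algebra.algHom]
  exact DFunLike.congr_fun this p

theorem eval₂_polynomialGerm_apply (G : Polynomial (Polynomial ℂ)) (F : analyticAtZero) (z : ℂ) :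
    (G.eval₂ polynomialGerm.toRingHom F).1 z = G.evalEval z (F.1 z) := by
  have h := Polynomial.hom_eval₂ G polynomialGerm.toRingHom
    ((Pi.evalRingHom (fun _ : ℂ => ℂ) z).comp analyticAtZero.val.toRingHom) F
  have h2 : ((Pi.evalRingHom (fun _ : ℂ => ℂ) z).comp analyticAtZero.val.toRingHom).comp
      polynomialGerm.toRingHom = Polynomial.evalRingHom z := by
    ext p <;> simp [polynomialGerm, coordinate]
  rw [h2] at h
  rw [← Polynomial.eval₂_evalRingHom]
  exact h

theorem constantCoeff_aeval (G : Polynomial (Polynomial ℂ)) (f : ℂ⟦X⟧) :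
    constantCoeff (Polynomial.aeval f G) = G.evalEval 0 (constantCoeff f) := by
  have h := Polynomial.hom_eval₂ G (algebraMap (Polynomial ℂ) ℂ⟦X⟧) (constantCoeff (R := ℂ)) f
  have h2 : (constantCoeff (R := ℂ)).comp (algebraMap (Polynomial ℂ) ℂ⟦X⟧)
      = Polynomial.evalRingHom 0 := by
    ext <;> simp [algebraMap_apply']
  rw [h2] at h
  rw [← Polynomial.eval₂_evalRingHom]
  exact h

theorem contDiff_evalEval (G : Polynomial (Polynomial ℂ)) :
    ContDiff ℂ ⊤ fun x : ℂ × ℂ => G.evalEval x.1 x.2 := by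
  have hp : ∀ p : Polynomial ℂ, ContDiff ℂ ⊤ fun x : ℂ × ℂ => p.eval x.1 := fun p => by
    have : ContDiff ℂ ⊤ fun z : ℂ => p.eval z := by
      simpa [Polynomial.aeval_def] using p.contDiff_aeval (𝕜 := ℂ) (n := ⊤)
    exact this.comp contDiff_fst
  induction G using Polynomial.induction_on' with
  | add p q hp hq => simpa using hp.add hq
  | monomial k p =>
    have : (fun x : ℂ × ℂ => (Polynomial.monomial k p).evalEval x.1 x.2)
        = fun x => p.eval x.1 * x.2 ^ k := by
      ext x; simp [Polynomial.evalEval]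
    rw [this]
    exact (hp p).mul (contDiff_snd.pow k)

/-- A simple root at the origin of a bivariate polynomial extends to an analytic root. -/
theorem exists_analytic_root {G : Polynomial (Polynomial ℂ)} (h0 : G.evalEval 0 0 = 0)
    (h1 : G.derivative.evalEval 0 0 ≠ 0) :
    ∃ F : analyticAtZero, F.1 0 = 0 ∧ Polynomial.aeval (taylorHom F) G = 0 := by
  set g : ℂ × ℂ → ℂ := fun x => G.evalEval x.1 x.2 with hg
  have cdf : ContDiffAt ℂ ⊤ g ((0, 0) : ℂ × ℂ) := (contDiff_evalEval G).contDiffAt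
  -- The partial derivative in the second variable, computed along y ↦ (0, y), is multiplication by
  -- a nonzero scalar.
  have hinr : (fderiv ℂ g (0, 0)).comp (.inr ℂ ℂ ℂ)
      = ContinuousLinearMap.toSpanSingleton ℂ (G.derivative.evalEval 0 0) := by
    have hd : HasFDerivAt g (fderiv ℂ g (0, 0)) ((ContinuousLinearMap.inr ℂ ℂ ℂ) 0) :=
      (cdf.differentiableAt (by simp)).hasFDerivAt
    have h2 := hd.comp (0 : ℂ) (ContinuousLinearMap.inr ℂ ℂ ℂ).hasFDerivAt
    have h3 : HasDerivAt (g ∘ ContinuousLinearMap.inr ℂ ℂ ℂ) (G.derivative.evalEval 0 0) 0 := by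
      have := (G.map (Polynomial.evalRingHom 0)).hasDerivAt (0 : ℂ)
      rw [Polynomial.derivative_map] at this
      have e : g ∘ ContinuousLinearMap.inr ℂ ℂ ℂ
          = fun y => (G.map (Polynomial.evalRingHom 0)).eval y := by
        ext y; simp [hg, Polynomial.map_evalRingHom_eval]
      rw [e]
      simpa [Polynomial.map_evalRingHom_eval] using this
    exact h2.unique h3.hasFDerivAt
  have inv : ((fderiv ℂ g (0, 0)).comp (.inr ℂ ℂ ℂ)).IsInvertible := by
    rw [hinr]
    refine ⟨ContinuousLinearEquiv.unitsEquivAut ℂ (Units.mk0 _ h1), ?_⟩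
    ext; simp
  have hF := cdf.contDiffAt_implicitFunction (by simp) inv
  set ψ := cdf.implicitFunction (by simp) inv
  have hψ : AnalyticAt ℂ ψ 0 := hF.analyticAt
  refine ⟨⟨ψ, hψ⟩, cdf.implicitFunction_apply_self (by simp) inv, ?_⟩
  have hz : taylorHom (G.eval₂ polynomialGerm.toRingHom ⟨ψ, hψ⟩) = 0 := by
    apply taylorHom_eq_zero_of_eventually
    have := cdf.eventually_apply_implicitFunction (by simp) inv
    filter_upwards [this] with z hz
    rw [eval₂_polynomialGerm_apply]
    exact hz.trans h0
  rw [← hz]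
  have := Polynomial.hom_eval₂ G polynomialGerm.toRingHom taylorHom.toRingHom ⟨ψ, hψ⟩
  refine Eq.trans ?_ this.symm
  have e : taylorHom.toRingHom.comp polynomialGerm.toRingHom
      = algebraMap (Polynomial ℂ) ℂ⟦X⟧ := RingHom.ext taylorHom_polynomialGerm
  rw [e]
  rfl

/-- Expanding `G` around `f` gives (G'(f) + c (g - f)) (g - f) = 0, and the first factor has nonzero
constant term. -/
theorem powerSeries_root_unique {G : Polynomial (Polynomial ℂ)}
    (h1 : G.derivative.evalEval 0 0 ≠ 0) {f g : ℂ⟦X⟧} (hf : constantCoeff f = 0)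
    (hg : constantCoeff g = 0) (hGf : Polynomial.aeval f G = 0) (hGg : Polynomial.aeval g G = 0) :
    f = g := by
  obtain ⟨c, hc⟩ := Polynomial.binomExpansion (G.map (algebraMap (Polynomial ℂ) ℂ⟦X⟧)) f (g - f)
  rw [add_sub_cancel, Polynomial.derivative_map, Polynomial.eval_map_algebraMap,
    Polynomial.eval_map_algebraMap, Polynomial.eval_map_algebraMap, hGf, hGg] at hc
  have h2 : (Polynomial.aeval f G.derivative + c * (g - f)) * (g - f) = 0 := by
    rw [eq_comm] at hc; linear_combination hc
  rcases mul_eq_zero.mp h2 with h | h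
  · have := congrArg (constantCoeff (R := ℂ)) h
    rw [map_add, constantCoeff_aeval, hf] at this
    simp [hf, hg] at this
    exact absurd this h1
  · exact (sub_eq_zero.mp h).symm

theorem X_pow_dvd_of_algebraMap {p : Polynomial ℂ} {k : ℕ}
    (h : (PowerSeries.X : ℂ⟦X⟧) ^ k ∣ algebraMap (Polynomial ℂ) ℂ⟦X⟧ p) :
    (Polynomial.X : Polynomial ℂ) ^ k ∣ p := by
  rw [Polynomial.X_pow_dvd_iff]
  rw [PowerSeries.X_pow_dvd_iff] at h
  intro m hm
  simpa [algebraMap_apply'] using h m hm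

/-- A power series that is algebraic over the polynomials is the Taylor series of a function
analytic at the origin. -/
theorem exists_taylorHom_eq_of_isAlgebraic {f : ℂ⟦X⟧} (hf : IsAlgebraic (Polynomial ℂ) f) :
    ∃ F : analyticAtZero, taylorHom F = f := by
  let ι := algebraMap (Polynomial ℂ) ℂ⟦X⟧
  have hιX : ι Polynomial.X = X := by simp [ι, algebraMap_apply']
  have hinj : Function.Injective ι := by
    intro a b h
    simpa [ι, algebraMap_apply'] using h
  obtain ⟨P, ⟨hP0, hPf⟩, hPmin⟩ := (measure Polynomial.natDegree).wf.has_min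
    {P : Polynomial (Polynomial ℂ) | P ≠ 0 ∧ Polynomial.aeval f P = 0} hf
  have hdeg : P.natDegree ≠ 0 := by
    intro h
    rw [Polynomial.eq_C_of_natDegree_eq_zero h] at hPf hP0
    rw [Polynomial.aeval_C] at hPf
    exact hP0 (by rw [hinj (hPf.trans (map_zero ι).symm), map_zero])
  -- In characteristic zero the derivative is nonzero and of smaller degree, so minimality of `P`
  -- applies.
  have hder : Polynomial.aeval f P.derivative ≠ 0 := by
    intro h
    refine hPmin P.derivative ⟨fun h0 => hdeg ?_, h⟩ (Polynomial.natDegree_derivative_lt hdeg)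
    exact Polynomial.derivative_eq_zero.mp h0
  have hkill : ∀ {k : ℕ} {a : ℂ⟦X⟧}, (X : ℂ⟦X⟧) ^ k * a = 0 → a = 0 := fun h =>
    (mul_eq_zero.mp h).resolve_left (pow_ne_zero _ X_ne_zero)
  obtain ⟨k, w, hw0, hw⟩ : ∃ (k : ℕ) (w : ℂ⟦X⟧), constantCoeff w ≠ 0 ∧
      Polynomial.aeval f P.derivative = X ^ k * w := by
    obtain ⟨k, v, hv⟩ := IsDiscreteValuationRing.eq_unit_mul_pow_irreducible hder
      (X_irreducible (R := ℂ))
    exact ⟨k, v, ((PowerSeries.isUnit_iff_constantCoeff).mp v.isUnit).ne_zero,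
      by rw [hv, mul_comm]⟩
  -- One order beyond the order `k` of P'(f): then P'(p) still has order exactly `k`, and f = p +
  -- X^k (X g') with a correction X g' vanishing at 0.
  obtain ⟨p, g', hfp⟩ : ∃ (p : Polynomial ℂ) (g' : ℂ⟦X⟧), f = ι p + X ^ (k + 1) * g' := by
    have : (X : ℂ⟦X⟧) ^ (k + 1) ∣ f - ι (trunc (k + 1) f) := by
      rw [PowerSeries.X_pow_dvd_iff]
      intro m hm
      simp [ι, algebraMap_apply', coeff_trunc, hm]
    obtain ⟨g', hg'⟩ := this
    exact ⟨_, g', by rw [← hg']; ring⟩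
  have heval : ∀ (Q : Polynomial (Polynomial ℂ)) (q : Polynomial ℂ),
      Polynomial.aeval (ι q) Q = ι (Q.eval q) := fun Q q =>
    Polynomial.aeval_algebraMap_apply_eq_algebraMap_eval q Q
  obtain ⟨u, hu, hu0⟩ : ∃ u : Polynomial ℂ, P.derivative.eval p = Polynomial.X ^ k * u ∧
      u.eval 0 ≠ 0 := by
    obtain ⟨c, hc⟩ : ι p - f ∣ ι (P.derivative.eval p) - Polynomial.aeval f P.derivative := by
      rw [← heval, ← Polynomial.eval_map_algebraMap, ← Polynomial.eval_map_algebraMap]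
      exact Polynomial.sub_dvd_eval_sub _ _ _
    have e : ι (P.derivative.eval p) = X ^ k * (w - X * g' * c) := by
      rw [hw] at hc
      rw [sub_eq_iff_eq_add.mp hc, hfp]
      ring
    obtain ⟨u, hu⟩ := X_pow_dvd_of_algebraMap (Dvd.intro _ e.symm)
    refine ⟨u, hu, ?_⟩
    have e2 : ι u = w - X * g' * c := by
      rw [hu, map_mul, map_pow, hιX] at e
      exact mul_left_cancel₀ (pow_ne_zero _ X_ne_zero) e
    have e3 := congrArg (constantCoeff (R := ℂ)) e2
    have e4 : constantCoeff (ι u) = u.eval 0 := by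
      simp [ι, algebraMap_apply', ← Polynomial.coeff_zero_eq_eval_zero]
    rw [← e4, e3]
    simpa using hw0
  -- Taylor expansion of P(p + X^k Y) with Y a formal variable, so that `R` is a polynomial in Y
  -- valid for every substituted series.
  obtain ⟨R, hR⟩ := Polynomial.binomExpansion (P.map Polynomial.C) (Polynomial.C p)
    (Polynomial.C (Polynomial.X ^ k) * Polynomial.X)
  have hexp : ∀ g : ℂ⟦X⟧, Polynomial.aeval (ι p + X ^ k * g) P = ι (P.eval p)
      + X ^ k * X ^ k * (ι u * g) + X ^ k * X ^ k * (Polynomial.aeval g R * g ^ 2) := by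
    intro g
    have h := congrArg (Polynomial.aeval g) hR
    have e1 : ((Polynomial.aeval g : Polynomial (Polynomial ℂ) →ₐ[Polynomial ℂ] ℂ⟦X⟧) :
        Polynomial (Polynomial ℂ) →+* ℂ⟦X⟧).comp Polynomial.C = ι := by
      ext <;> simp [ι]
    have e2 : ∀ (Q : Polynomial (Polynomial ℂ)) x,
        Polynomial.aeval g ((Q.map Polynomial.C).eval x) =
        Polynomial.aeval (Polynomial.aeval g x) Q := by
      intro Q x
      rw [Polynomial.eval_map]
      have := Polynomial.hom_eval₂ Q Polynomial.C ((Polynomial.aeval g :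
        Polynomial (Polynomial ℂ) →ₐ[Polynomial ℂ] ℂ⟦X⟧) : Polynomial (Polynomial ℂ) →+* ℂ⟦X⟧) x
      rw [e1] at this
      exact this
    have e3 : ∀ q, Polynomial.aeval g (Polynomial.C q) = ι q := fun q => Polynomial.aeval_C _ _
    simp only [map_add, map_mul, map_pow, e2, Polynomial.derivative_map, e3, Polynomial.aeval_X,
      hιX, heval, hu] at h
    rw [h]
    ring
  have hg0 : constantCoeff (X * g') = (0 : ℂ) := by simp
  have hf2 : f = ι p + X ^ k * (X * g') := by rw [hfp]; ring
  have h0 := hexp (X * g')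
  rw [← hf2, hPf] at h0
  -- P(f) = 0 and all other terms of the expansion are divisible by X^{2k}.
  obtain ⟨q, hq⟩ : (Polynomial.X : Polynomial ℂ) ^ (k + k) ∣ P.eval p := by
    apply X_pow_dvd_of_algebraMap
    refine Dvd.intro (-(ι u * (X * g') + Polynomial.aeval (X * g') R * (X * g') ^ 2)) ?_
    change _ = ι _
    rw [pow_add]
    linear_combination h0
  -- Dividing P(p + X^k Y) by X^{2k} turns a possibly degenerate root into a simple one: the
  -- Y-derivative of `G` at the origin is u(0) ≠ 0.
  set G : Polynomial (Polynomial ℂ) :=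
    Polynomial.C q + Polynomial.C u * Polynomial.X + R * Polynomial.X ^ 2 with hG
  have hGg : ∀ g : ℂ⟦X⟧, Polynomial.aeval (ι p + X ^ k * g) P
      = X ^ (k + k) * Polynomial.aeval g G := by
    intro g
    rw [hexp, hq, hG]
    simp only [map_add, map_mul, map_pow, Polynomial.aeval_C, Polynomial.aeval_X, hιX]
    change _ = X ^ (k + k) * (ι q + ι u * g + _)
    ring
  have hroot : Polynomial.aeval (X * g') G = 0 := by
    refine hkill (k := k + k) ?_
    rw [← hGg, ← hf2, hPf]
  have hG0 : G.evalEval 0 0 = 0 := by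
    have := constantCoeff_aeval G (X * g')
    rwa [hroot, hg0, map_zero, eq_comm] at this
  have hG1 : G.derivative.evalEval 0 0 ≠ 0 := by
    simpa [hG, Polynomial.evalEval] using hu0
  obtain ⟨F, hF0, hF⟩ := exists_analytic_root hG0 hG1
  have hFg : taylorHom F = X * g' :=
    powerSeries_root_unique hG1 (by rw [constantCoeff_taylorHom, hF0]) hg0 hF hroot
  refine ⟨polynomialGerm p + polynomialGerm (Polynomial.X ^ k) * F, ?_⟩
  rw [map_add, map_mul, taylorHom_polynomialGerm, taylorHom_polynomialGerm, hFg, map_pow]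
  change ι p + ι Polynomial.X ^ k * _ = f
  rw [hιX, ← hf2]

/-! ### Expansion in a uniformizer -/

section Expansion

variable {k R : Type*} [Field k] [CommRing R] [Algebra k R] (ε : R →ₐ[k] k) (δ : R → R)

/-- The power series with coefficients `ε r, ε (δ r), ε (δ (δ r)), …`. -/
def expansion (r : R) : k⟦X⟧ := PowerSeries.mk fun m => ε (δ^[m] r)

theorem expansion_eq (r : R) :
    expansion ε δ r = PowerSeries.C (ε r) + X * expansion ε δ (δ r) := by
  ext (_ | m)
  · simp [expansion]
  · simp [expansion, coeff_succ_X_mul]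

theorem coeff_succ_expansion (r : R) (m : ℕ) :
    coeff (m + 1) (expansion ε δ r) = coeff m (expansion ε δ (δ r)) := by
  simp [expansion]

theorem constantCoeff_expansion (r : R) : constantCoeff (expansion ε δ r) = ε r := by
  simp [expansion, ← coeff_zero_eq_constantCoeff_apply]

variable {ε δ}

/-- Expansion in powers of a non-zero-divisor that generates the kernel of a character. -/
def expansionHom {ϖ : R} (hϖ : IsLeftRegular ϖ)
    (hδ : ∀ r, r = algebraMap k R (ε r) + ϖ * δ r) : R →ₐ[k] k⟦X⟧ :=
  -- `δ r` is (r - ε r) / ϖ. Cancelling ϖ shows that `δ` is additive and a derivation twisted by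
  -- `ε`, which drives the coefficient inductions below.
  have hadd : ∀ r s, δ (r + s) = δ r + δ s := fun r s => hϖ <| by
    have h := hδ (r + s)
    rw [map_add, map_add] at h
    linear_combination hδ r + hδ s - h
  have hmul : ∀ r s, δ (r * s) = δ r * s + algebraMap k R (ε r) * δ s := fun r s => hϖ <| by
    have h := hδ (r * s)
    rw [map_mul, map_mul] at h
    linear_combination s * hδ r + algebraMap k R (ε r) * hδ s - h
  have hC : ∀ c, δ (algebraMap k R c) = 0 := fun c => hϖ <| by
    have h := hδ (algebraMap k R c)
    rw [AlgHom.commutes, Algebra.algebraMap_self, RingHom.id_apply] at h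
    linear_combination -h
  have hadd' : ∀ r s, expansion ε δ (r + s) = expansion ε δ r + expansion ε δ s := fun r s => by
    ext m
    induction m generalizing r s with
    | zero => simp [constantCoeff_expansion]
    | succ m ih => rw [coeff_succ_expansion, hadd, ih, map_add, map_add, coeff_succ_expansion,
        coeff_succ_expansion]
  have hC' : ∀ c, expansion ε δ (algebraMap k R c) = PowerSeries.C c := fun c => by
    have h0 : expansion ε δ 0 = 0 := by simpa using hadd' 0 0
    rw [expansion_eq, hC, h0]
    simp
  have hmul' : ∀ r s, expansion ε δ (r * s) = expansion ε δ r * expansion ε δ s := fun r s => by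
    ext m
    induction m generalizing r s with
    | zero => simp [constantCoeff_expansion]
    | succ m ih =>
      rw [coeff_succ_expansion, hmul, hadd', map_add, ih, ih, hC', expansion_eq ε δ r, add_mul,
        map_add, coeff_C_mul, coeff_C_mul, coeff_succ_expansion, mul_assoc, coeff_succ_X_mul,
        add_comm]
  { toFun := expansion ε δ
    map_one' := by simpa using hC' 1
    map_zero' := by simpa using hC' 0
    map_add' := hadd'
    map_mul' := hmul'
    commutes' := hC' }

end Expansion

/-- A discrete valuation ring with a rational residue field embeds into the power series. -/
theorem exists_algHom_powerSeries_of_isDiscreteValuationRing {k R : Type*} [Field k] [CommRing R]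
    [IsDomain R] [IsDiscreteValuationRing R] [Algebra k R] (ε : R →ₐ[k] k) :
    ∃ φ : R →ₐ[k] k⟦X⟧, Function.Injective φ ∧ (∀ r, constantCoeff (φ r) = ε r) ∧
      ∃ ϖ, φ ϖ = X := by
  obtain ⟨ϖ, hϖ⟩ := IsDiscreteValuationRing.exists_irreducible R
  have hker : RingHom.ker ε = Ideal.span {ϖ} := by
    rw [← hϖ.maximalIdeal_eq]
    exact IsLocalRing.eq_maximalIdeal (RingHom.ker_isMaximal_of_surjective ε
      fun c => ⟨algebraMap k R c, by simp⟩)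
  have hex : ∀ r, ∃ s, r = algebraMap k R (ε r) + ϖ * s := fun r => by
    have : r - algebraMap k R (ε r) ∈ RingHom.ker ε := by simp [RingHom.mem_ker]
    rw [hker, Ideal.mem_span_singleton] at this
    obtain ⟨s, hs⟩ := this
    exact ⟨s, by rw [← hs]; ring⟩
  choose δ hδ using hex
  have hreg : IsLeftRegular ϖ := (IsRegular.of_ne_zero hϖ.ne_zero).left
  set φ := expansionHom hreg hδ with hφ
  have hφϖ : φ ϖ = X := by
    have h0 : ε ϖ = 0 := by
      have : ϖ ∈ RingHom.ker ε := by rw [hker]; exact Ideal.mem_span_singleton_self ϖ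
      exact this
    have h1 : δ ϖ = 1 := hreg <| by
      have := hδ ϖ
      rw [h0, map_zero, zero_add] at this
      simpa using this.symm
    have h2 : φ ϖ = PowerSeries.C (ε ϖ) + X * φ (δ ϖ) := expansion_eq ε δ ϖ
    rw [h2, h0, h1]
    simp
  refine ⟨φ, ?_, constantCoeff_expansion ε δ, ϖ, hφϖ⟩
  rw [injective_iff_map_eq_zero]
  intro r hr
  by_contra h
  obtain ⟨m, u, rfl⟩ := IsDiscreteValuationRing.eq_unit_mul_pow_irreducible h hϖ
  rw [map_mul, map_pow, hφϖ] at hr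
  exact mul_ne_zero (u.isUnit.map φ).ne_zero (pow_ne_zero _ X_ne_zero) hr

/-! ### Algebraic branches through points of affine varieties -/

/-- A maximal ideal of a finitely generated algebra over an algebraically closed field is the
kernel of a character. -/
theorem exists_algHom_ker_eq {k E : Type*} [Field k] [IsAlgClosed k] [CommRing E] [Algebra k E]
    [Algebra.FiniteType k E] (M : Ideal E) [hM : M.IsMaximal] :
    ∃ ε : E →ₐ[k] k, RingHom.ker ε = M := by
  let : Field (E ⧸ M) := Ideal.Quotient.field M
  have : Module.Finite k (E ⧸ M) := finite_of_finite_type_of_isJacobsonRing k (E ⧸ M)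
  have hb : Function.Bijective (Algebra.ofId k (E ⧸ M)) :=
    IsAlgClosed.algebraMap_bijective_of_isIntegral
  let e : k ≃ₐ[k] (E ⧸ M) := AlgEquiv.ofBijective _ hb
  refine ⟨(e.symm : (E ⧸ M) →ₐ[k] k).comp (Ideal.Quotient.mkₐ k M), ?_⟩
  ext x
  simp [RingHom.mem_ker, Ideal.Quotient.eq_zero_iff_mem]

/-- If `y` is algebraic over `k[x]` and `y` is transcendental, then `x` is algebraic over `k[y]`. -/
theorem isAlgebraic_X_exchange {k : Type*} [Field k] {s : k⟦X⟧} {F : Polynomial (Polynomial k)}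
    (hF : F ≠ 0) (h : Polynomial.aevalAeval s (X : k⟦X⟧) F = 0) :
    IsAlgebraic (Polynomial k) s := by
  refine ⟨Polynomial.Bivariate.swap F, by simpa using hF, ?_⟩
  rw [← Polynomial.Bivariate.aevalAeval_swap] at h
  rw [← h]
  generalize Polynomial.Bivariate.swap F = G
  have : (Polynomial.aeval (R := Polynomial k) s).restrictScalars k
      = Polynomial.aevalAeval X s := by
    apply Polynomial.algHom_ext'
    · ext; simp [algebraMap_apply']
    · simp
  exact DFunLike.congr_fun this G

/-- The polynomial ring acts on `R` through `s`, but on power series through `X`. The relation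
between ϖ and the generator of the first copy makes `s` algebraic over the second; transitivity then
handles every `φ r`. -/
theorem isAlgebraic_of_embedding {k R : Type*} [Field k] [CommRing R] [IsDomain R] [Algebra k R]
    [Algebra (Polynomial k) R] [IsScalarTower k (Polynomial k) R]
    [Algebra.IsAlgebraic (Polynomial k) R] [FaithfulSMul (Polynomial k) R]
    (φ : R →ₐ[k] k⟦X⟧) (hφ : Function.Injective φ) {ϖ : R} (hϖ : φ ϖ = X) (r : R) :
    IsAlgebraic (Polynomial k) (φ r) := by
  set s : k⟦X⟧ := φ (algebraMap (Polynomial k) R Polynomial.X) with hs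
  have hcomp : ∀ (r : R) (F : Polynomial (Polynomial k)),
      φ (Polynomial.aeval r F) = Polynomial.aevalAeval s (φ r) F := fun r F => by
    have : φ.comp ((Polynomial.aeval (R := Polynomial k) r).restrictScalars k)
        = Polynomial.aevalAeval s (φ r) := by
      apply Polynomial.algHom_ext'
      · ext; simp [hs]
      · simp
    exact DFunLike.congr_fun this F
  obtain ⟨F, hF0, hF⟩ := Algebra.IsAlgebraic.isAlgebraic (R := Polynomial k) ϖ
  have hsalg : IsAlgebraic (Polynomial k) s :=
    isAlgebraic_X_exchange hF0 (by rw [← hϖ, ← hcomp, hF, map_zero])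
  let T := Subalgebra.algebraicClosure (Polynomial k) k⟦X⟧
  let j : Polynomial k →ₐ[k] T := Polynomial.aeval ⟨s, hsalg⟩
  have hj : ∀ p, (j p : k⟦X⟧) = φ (algebraMap (Polynomial k) R p) := fun p => by
    have : (T.val.restrictScalars k).comp j
        = φ.comp (Algebra.algHom k (Polynomial k) R) := by
      ext; simp [j, hs, Algebra.algHom]
    exact DFunLike.congr_fun this p
  have hjinj : Function.Injective j := fun p q h => by
    have := congrArg (Subtype.val) h
    rw [hj, hj] at this
    exact FaithfulSMul.algebraMap_injective _ _ (hφ this)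
  obtain ⟨G, hG0, hG⟩ := Algebra.IsAlgebraic.isAlgebraic (R := Polynomial k) r
  have : IsAlgebraic T (φ r) := by
    refine ⟨G.map j.toRingHom, (Polynomial.map_ne_zero_iff hjinj).mpr hG0, ?_⟩
    rw [Polynomial.aeval_def, Polynomial.eval₂_map]
    have h := Polynomial.hom_eval₂ G (algebraMap (Polynomial k) R) φ.toRingHom r
    have e : (algebraMap T k⟦X⟧).comp j.toRingHom
        = φ.toRingHom.comp (algebraMap (Polynomial k) R) := RingHom.ext hj
    rw [e]
    refine h.symm.trans ?_
    change φ (Polynomial.aeval r G) = 0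
    rw [hG, map_zero]
  exact this.restrictScalars _

/-- Localizing at the kernel of `ε` gives a discrete valuation ring with residue field `k`, to be
expanded in a uniformizer. -/
theorem exists_algHom_of_isDedekindDomain {k E : Type*} [Field k] [CommRing E]
    [IsDedekindDomain E] [Algebra k E]
    [Algebra (Polynomial k) E] [IsScalarTower k (Polynomial k) E]
    [Algebra.IsAlgebraic (Polynomial k) E] [FaithfulSMul (Polynomial k) E] (ε : E →ₐ[k] k)
    (hε : RingHom.ker ε ≠ ⊥) :
    ∃ ψ : E →ₐ[k] k⟦X⟧, Function.Injective ψ ∧ (∀ b, constantCoeff (ψ b) = ε b) ∧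
      ∀ b, IsAlgebraic (Polynomial k) (ψ b) := by
  let M := RingHom.ker ε
  have hM : M.IsPrime := RingHom.ker_isPrime ε
  let R := Localization.AtPrime M
  have : IsDiscreteValuationRing R :=
    IsLocalization.AtPrime.isDiscreteValuationRing_of_dedekind_domain E hε R
  have hu : ∀ y : M.primeCompl, IsUnit (ε y) := fun y =>
    isUnit_iff_ne_zero.mpr fun h => y.2 h
  let εR : R →ₐ[k] k := IsLocalization.liftAlgHom (M := M.primeCompl) (f := ε) hu
  obtain ⟨φ, hφ, hc, ϖ, hϖ⟩ := exists_algHom_powerSeries_of_isDiscreteValuationRing εR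
  have hER : Function.Injective (algebraMap E R) :=
    IsLocalization.injective R M.primeCompl_le_nonZeroDivisors
  have : FaithfulSMul E R := (faithfulSMul_iff_algebraMap_injective E R).mpr hER
  have : FaithfulSMul (Polynomial k) R := FaithfulSMul.trans (Polynomial k) E R
  have : Algebra.IsAlgebraic E R := IsLocalization.isAlgebraic R M.primeCompl
  have : Algebra.IsAlgebraic (Polynomial k) R := Algebra.IsAlgebraic.trans (Polynomial k) E R
  refine ⟨φ.comp (Algebra.algHom k E R), hφ.comp hER, fun b => ?_, fun b => ?_⟩
  · exact (hc _).trans (IsLocalization.lift_eq hu b)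
  · exact isAlgebraic_of_embedding φ hφ hϖ _

/-- Every point of an affine curve, finite over the line, is the centre of an algebraic branch. -/
theorem exists_algHom_of_finite_polynomial {k D : Type*} [Field k] [IsAlgClosed k] [CharZero k]
    [CommRing D] [IsDomain D] [Algebra k D] (κ : Polynomial k →ₐ[k] D)
    (hκ : Function.Injective κ) (hfin : κ.Finite) (ε : D →ₐ[k] k) (hε : RingHom.ker ε ≠ ⊥) :
    ∃ ψ : D →ₐ[k] k⟦X⟧, Function.Injective ψ ∧ (∀ b, constantCoeff (ψ b) = ε b) ∧
      ∀ b, IsAlgebraic (Polynomial k) (ψ b) := by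
  let : Algebra (Polynomial k) D := κ.toAlgebra
  have : IsScalarTower k (Polynomial k) D := IsScalarTower.of_algebraMap_eq' κ.comp_algebraMap.symm
  have : FaithfulSMul (Polynomial k) D := (faithfulSMul_iff_algebraMap_injective _ _).mpr hκ
  have : Module.Finite (Polynomial k) D := hfin
  let L := FractionRing D
  let := FractionRing.liftAlgebra (Polynomial k) L
  have : IsScalarTower (Polynomial k) (FractionRing (Polynomial k)) L :=
    FractionRing.isScalarTower_liftAlgebra _ _
  have : FiniteDimensional (FractionRing (Polynomial k)) L :=
    .of_isLocalization (Polynomial k) D (nonZeroDivisors (Polynomial k))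
  have : CharZero (FractionRing (Polynomial k)) :=
    charZero_of_injective_algebraMap (IsFractionRing.injective (Polynomial k) _)
  -- The normalization of the curve. Characteristic zero makes the field extension separable, so `E`
  -- is finite over the polynomial ring.
  let E := integralClosure (Polynomial k) L
  have : IsDedekindDomain E := inferInstance
  have : Module.Finite (Polynomial k) E :=
    IsIntegralClosure.finite (Polynomial k) (FractionRing (Polynomial k)) L E
  have : Algebra.FiniteType k E := .trans (S := Polynomial k) inferInstance inferInstance
  let i : D →ₐ[Polynomial k] E := IsIntegralClosure.lift (Polynomial k) E L
  have hi : Function.Injective i := fun x y h => by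
    have h2 := congrArg (algebraMap E L) h
    rw [IsIntegralClosure.algebraMap_lift, IsIntegralClosure.algebraMap_lift] at h2
    exact IsFractionRing.injective D L h2
  let : Algebra D E := i.toRingHom.toAlgebra
  have : IsScalarTower (Polynomial k) D E := IsScalarTower.of_algebraMap_eq' i.comp_algebraMap.symm
  have : Algebra.IsIntegral D E := Algebra.IsIntegral.tower_top (Polynomial k)
  have hεm : (RingHom.ker ε).IsMaximal :=
    RingHom.ker_isMaximal_of_surjective ε fun c => ⟨algebraMap k D c, by simp⟩
  -- Lying over lifts the point to the normalization, and the Nullstellensatz makes the lift a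
  -- character.
  obtain ⟨M, hM, hMε⟩ := Ideal.exists_ideal_over_maximal_of_isIntegral (S := E) (RingHom.ker ε)
    (((RingHom.injective_iff_ker_eq_bot (algebraMap D E)).mp hi).trans_le bot_le)
  obtain ⟨εE, hεE⟩ := exists_algHom_ker_eq (k := k) M
  have hεi : ∀ d, εE (i d) = ε d := fun d => by
    have h1 : d - algebraMap k D (ε d) ∈ RingHom.ker ε := by simp [RingHom.mem_ker]
    rw [← hMε, ← hεE, Ideal.mem_comap, RingHom.mem_ker] at h1
    have h2 : εE ((i.restrictScalars k) (d - algebraMap k D (ε d))) = 0 := h1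
    rw [map_sub, map_sub, AlgHom.commutes, AlgHom.commutes] at h2
    exact sub_eq_zero.mp h2
  have hne : RingHom.ker εE ≠ ⊥ := by
    obtain ⟨d, hd, hd0⟩ := Submodule.exists_mem_ne_zero_of_ne_bot hε
    intro h
    have h1 : i d ∈ RingHom.ker εE := by rw [RingHom.mem_ker, hεi]; exact hd
    rw [h, Ideal.mem_bot] at h1
    exact hd0 (hi (h1.trans (map_zero i).symm))
  obtain ⟨ψ, hψ, hc, halg⟩ := exists_algHom_of_isDedekindDomain εE hne
  exact ⟨ψ.comp (i.restrictScalars k), hψ.comp hi, fun b => (hc _).trans (hεi b), fun b => halg _⟩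

/-- A point of an affine variety on which a nonzero function `t` vanishes is the centre of an
algebraic branch that is not contained in the zero locus of `t`. -/
theorem exists_algHom_powerSeries_map_ne_zero {k B : Type*} [Field k] [IsAlgClosed k] [CharZero k]
    [CommRing B] [IsDomain B] [Algebra k B] [Algebra.FiniteType k B] (ε : B →ₐ[k] k) {t : B}
    (ht : t ≠ 0) (hεt : ε t = 0) :
    ∃ ψ : B →ₐ[k] k⟦X⟧, ψ t ≠ 0 ∧ (∀ b, constantCoeff (ψ b) = ε b) ∧
      ∀ b, IsAlgebraic (Polynomial k) (ψ b) := by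
  obtain ⟨e, g, hg, hgfin⟩ := exists_finite_inj_algHom_of_fg k B
  let A := MvPolynomial (Fin e) k
  let : Algebra A B := g.toRingHom.toAlgebra
  have : Module.Finite A B := hgfin
  have : FaithfulSMul A B := (faithfulSMul_iff_algebraMap_injective _ _).mpr hg
  -- A multiple of `t` coming from affine space: a line on which `a` is not identically zero will
  -- keep `t` nonzero on the curve above it.
  obtain ⟨a, ha0, hta⟩ := (Algebra.IsAlgebraic.isAlgebraic (R := A) t).exists_nonzero_dvd
    (mem_nonZeroDivisors_of_ne_zero ht)
  let y₀ : Fin e → k := fun i => ε (g (MvPolynomial.X i))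
  have hy₀ : ∀ p : A, MvPolynomial.eval y₀ p = ε (g p) := fun p => by
    have : MvPolynomial.aeval y₀ = ε.comp g := by ext; simp [y₀]
    rw [← MvPolynomial.coe_aeval_eq_eval]
    exact DFunLike.congr_fun this p
  obtain ⟨y₁, hy₁⟩ : ∃ y₁, MvPolynomial.eval y₁ a ≠ 0 := by
    by_contra! h
    exact ha0 (MvPolynomial.funext fun y => by simpa using h y)
  have hay₀ : MvPolynomial.eval y₀ a = 0 := by
    obtain ⟨c, hc⟩ := hta
    rw [hy₀]
    change ε (algebraMap A B a) = 0
    rw [hc, map_mul, hεt, zero_mul]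
  obtain ⟨i, hi⟩ : ∃ i, y₁ i ≠ y₀ i := by
    by_contra! h
    exact hy₁ (by rw [funext h, hay₀])
  let line : A →ₐ[k] Polynomial k := MvPolynomial.aeval fun i =>
    Polynomial.C (y₀ i) + Polynomial.C (y₁ i - y₀ i) * Polynomial.X
  let σ : Polynomial k →ₐ[k] A := Polynomial.aeval
    (MvPolynomial.C (y₁ i - y₀ i)⁻¹ * (MvPolynomial.X i - MvPolynomial.C (y₀ i)))
  have hσ : ∀ p, line (σ p) = p := fun p => by
    have hX : line (MvPolynomial.X i) = _ := MvPolynomial.aeval_X _ i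
    have hC : ∀ c, line (MvPolynomial.C c) = Polynomial.C c := line.commutes
    have : line.comp σ = AlgHom.id k _ := by
      apply Polynomial.algHom_ext
      simp only [σ, AlgHom.comp_apply, Polynomial.aeval_X, map_mul, map_sub, hX, hC,
        AlgHom.id_apply, add_sub_cancel_left]
      rw [← map_sub, ← mul_assoc, ← Polynomial.C_mul, inv_mul_cancel₀ (sub_ne_zero.mpr hi),
        map_one, one_mul]
    exact DFunLike.congr_fun this p
  have hline : ∀ (c : k) (p : A), (line p).eval c
      = MvPolynomial.eval (fun i => y₀ i + (y₁ i - y₀ i) * c) p := fun c p => by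
    have : (Polynomial.aeval c).comp line
        = MvPolynomial.aeval (fun i => y₀ i + (y₁ i - y₀ i) * c) := by
      ext; simp [line]
    rw [← MvPolynomial.coe_aeval_eq_eval, ← Polynomial.coe_aeval_eq_eval]
    exact DFunLike.congr_fun this p
  let q : Ideal A := RingHom.ker line
  have hq : q.IsPrime := RingHom.ker_isPrime line
  let m : Ideal B := RingHom.ker ε
  have hm : m.IsPrime := RingHom.ker_isPrime ε
  have hqm : q ≤ m.under A := fun p hp => by
    have hp' : line p = 0 := hp
    have := hline 0 p
    rw [hp'] at this
    simp only [Polynomial.eval_zero, mul_zero, add_zero] at this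
    change ε (g p) = 0
    rw [← hy₀]
    exact this.symm
  -- Going down over the normal ring `A`: the curve defined by `Q` lies over the line and still
  -- passes through the given point.
  obtain ⟨Q, hQm, hQ, hQq⟩ := Ideal.exists_ideal_le_liesOver_of_le (q := m.under A) m hqm
  have hgQ : ∀ p : A, g p ∈ Q ↔ line p = 0 := fun p => by
    have : p ∈ q ↔ p ∈ Q.under A := by rw [← hQq.over]
    exact this.symm
  let κ : Polynomial k →ₐ[k] B ⧸ Q := ((Ideal.Quotient.mkₐ k Q).comp g).comp σ
  have hκ : Function.Injective κ := by
    rw [injective_iff_map_eq_zero]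
    intro p hp
    have := (hgQ (σ p)).mp (Ideal.Quotient.eq_zero_iff_mem.mp hp)
    rwa [hσ] at this
  have hκline : κ.comp line = (Ideal.Quotient.mkₐ k Q).comp g := by
    refine AlgHom.ext fun p => ?_
    refine Ideal.Quotient.eq.mpr ?_
    change g (σ (line p)) - g p ∈ Q
    rw [← map_sub, hgQ, map_sub, hσ, sub_self]
  have hκfin : κ.Finite := by
    refine AlgHom.Finite.of_comp_finite (f := line) ?_
    rw [hκline]
    exact AlgHom.Finite.comp (AlgHom.Finite.of_surjective _ (Ideal.Quotient.mkₐ_surjective k Q))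
      hgfin
  let εD : (B ⧸ Q) →ₐ[k] k := Ideal.Quotient.liftₐ Q ε fun b hb => hQm hb
  have htQ : (Ideal.Quotient.mkₐ k Q) t ≠ 0 := by
    intro h
    have h1 : t ∈ Q := Ideal.Quotient.eq_zero_iff_mem.mp h
    have h2 : g a ∈ Q := Q.mem_of_dvd hta h1
    have h3 := hline 1 a
    rw [(hgQ a).mp h2] at h3
    simp at h3
    exact hy₁ h3.symm
  have hεD : RingHom.ker εD ≠ ⊥ := by
    intro h
    have h1 : Ideal.Quotient.mkₐ k Q t ∈ RingHom.ker εD := hεt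
    rw [h] at h1
    exact htQ h1
  obtain ⟨ψ, hψ, hc, halg⟩ := exists_algHom_of_finite_polynomial κ hκ hκfin εD hεD
  exact ⟨ψ.comp (Ideal.Quotient.mkₐ k Q), fun h => htQ (hψ (h.trans (map_zero ψ).symm)),
    fun b => hc _, fun b => halg _⟩

/-! ### Curve selection -/

/-- The ideal of polynomials that vanish on a set. -/
noncomputable def idealOf {n : ℕ} (S : Set (Fin n → ℂ)) : Ideal (MvPolynomial (Fin n) ℂ) :=
  ⨅ x ∈ S, RingHom.ker (MvPolynomial.eval x)

theorem mem_idealOf {n : ℕ} {S : Set (Fin n → ℂ)} {p : MvPolynomial (Fin n) ℂ} :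
    p ∈ idealOf S ↔ ∀ x ∈ S, MvPolynomial.eval x p = 0 := by
  simp [idealOf, RingHom.mem_ker]

/-- Some irreducible component of the Zariski closure of `S` contains a given limit point of `S`
and is not contained in the zero locus of a polynomial without zeros on `S`. -/
theorem exists_isPrime_idealOf_le {n : ℕ} {S : Set (Fin n → ℂ)} {x₀ : Fin n → ℂ}
    (hx : x₀ ∈ closure S) {t : MvPolynomial (Fin n) ℂ} (ht : ∀ x ∈ S, MvPolynomial.eval x t ≠ 0) :
    ∃ P : Ideal (MvPolynomial (Fin n) ℂ), P.IsPrime ∧ idealOf S ≤ P ∧ t ∉ P ∧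
      P ≤ RingHom.ker (MvPolynomial.eval x₀) := by
  by_contra! hcon
  set I := idealOf S
  have hfin : I.minimalPrimes.Finite := Ideal.finite_minimalPrimes_of_isNoetherianRing _ I
  -- If no component works, each minimal prime contains a polynomial without zeros on `S` near `x₀`.
  -- A power of their product vanishes on `S`, contradicting that `x₀` is a limit point.
  have hg : ∀ P ∈ I.minimalPrimes, ∃ g ∈ P, ∀ᶠ x in 𝓝[S] x₀, MvPolynomial.eval x g ≠ 0 := by
    intro P hP
    by_cases htP : t ∈ P
    · exact ⟨t, htP, eventually_nhdsWithin_of_forall ht⟩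
    · obtain ⟨g, hgP, hgx⟩ := Set.not_subset.mp (hcon P hP.1.1 hP.1.2 htP)
      refine ⟨g, hgP, Filter.Eventually.filter_mono nhdsWithin_le_nhds ?_⟩
      have hc : Continuous fun x : Fin n → ℂ => MvPolynomial.eval x g :=
        MvPolynomial.continuous_eval g
      exact hc.continuousAt.eventually_ne hgx
  choose! g hgP hgx using hg
  have hprod : ∏ P ∈ hfin.toFinset, g P ∈ I.radical := by
    rw [← Ideal.sInf_minimalPrimes, Submodule.mem_sInf]
    intro P hP
    exact Ideal.mem_of_dvd _ (Finset.dvd_prod_of_mem g (hfin.mem_toFinset.mpr hP)) (hgP P hP)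
  obtain ⟨N, hN⟩ := hprod
  have : (𝓝[S] x₀).NeBot := mem_closure_iff_nhdsWithin_neBot.mp hx
  have hev : ∀ᶠ x in 𝓝[S] x₀, x ∈ S ∧ ∀ P ∈ hfin.toFinset, MvPolynomial.eval x (g P) ≠ 0 := by
    refine eventually_mem_nhdsWithin.and ((Filter.eventually_all_finset _).mpr fun P hP => ?_)
    exact hgx P (hfin.mem_toFinset.mp hP)
  obtain ⟨x, hxS, hx'⟩ := hev.exists
  have h0 := mem_idealOf.mp hN x hxS
  rw [map_pow, map_prod] at h0
  exact Finset.prod_ne_zero_iff.mpr hx' (eq_zero_of_pow_eq_zero h0)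

theorem aeval_analyticAtZero_apply {n : ℕ} (F : Fin n → analyticAtZero)
    (p : MvPolynomial (Fin n) ℂ) (z : ℂ) :
    (MvPolynomial.aeval F p).1 z = MvPolynomial.eval (fun i => (F i).1 z) p := by
  have : ((Pi.evalAlgHom ℂ (fun _ : ℂ => ℂ) z).comp analyticAtZero.val).comp
      (MvPolynomial.aeval F) = MvPolynomial.aeval fun i => (F i).1 z := by
    ext; simp
  rw [← MvPolynomial.coe_aeval_eq_eval]
  exact DFunLike.congr_fun this p

/-- **Curve selection**: a limit point `x₀` of a set `S` at which the polynomial `t`, without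
zeros on `S`, vanishes is the centre of an analytic curve in the Zariski closure of `S` along which
`t` is not identically zero. -/
theorem exists_analytic_curve {n : ℕ} {S : Set (Fin n → ℂ)} {x₀ : Fin n → ℂ}
    (hx : x₀ ∈ closure S) {t : MvPolynomial (Fin n) ℂ} (ht : ∀ x ∈ S, MvPolynomial.eval x t ≠ 0)
    (ht₀ : MvPolynomial.eval x₀ t = 0) :
    ∃ γ : Fin n → ℂ → ℂ, (∀ i, AnalyticAt ℂ (γ i) 0) ∧ (∀ i, γ i 0 = x₀ i) ∧
      (∀ᶠ z in 𝓝 (0 : ℂ), ∀ p ∈ idealOf S, MvPolynomial.eval (fun i => γ i z) p = 0) ∧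
      ¬ ∀ᶠ z in 𝓝 (0 : ℂ), MvPolynomial.eval (fun i => γ i z) t = 0 := by
  obtain ⟨P, hP, hIP, htP, hPx⟩ := exists_isPrime_idealOf_le hx ht
  let B := MvPolynomial (Fin n) ℂ ⧸ P
  let mk : MvPolynomial (Fin n) ℂ →ₐ[ℂ] B := Ideal.Quotient.mkₐ ℂ P
  have hev : ∀ p : MvPolynomial (Fin n) ℂ,
      MvPolynomial.aeval x₀ p = MvPolynomial.eval x₀ p := fun p => by
    rw [← MvPolynomial.coe_aeval_eq_eval]; rfl
  let ε : B →ₐ[ℂ] ℂ := Ideal.Quotient.liftₐ P (MvPolynomial.aeval x₀) fun p hp =>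
    (hev p).trans (hPx hp)
  have hε : ∀ p, ε (mk p) = MvPolynomial.eval x₀ p := fun p => hev p
  have htB : mk t ≠ 0 := fun h => htP (Ideal.Quotient.eq_zero_iff_mem.mp h)
  obtain ⟨ψ, hψt, hψc, hψa⟩ :=
    exists_algHom_powerSeries_map_ne_zero ε htB ((hε t).trans ht₀)
  choose F hF using fun i => exists_taylorHom_eq_of_isAlgebraic (hψa (mk (MvPolynomial.X i)))
  have hT : ∀ p, taylorHom (MvPolynomial.aeval F p) = ψ (mk p) := fun p => by
    have : taylorHom.comp (MvPolynomial.aeval F) = ψ.comp mk := by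
      ext1 i; simp [hF]
    exact DFunLike.congr_fun this p
  have hvan : ∀ p ∈ idealOf S,
      ∀ᶠ z in 𝓝 (0 : ℂ), MvPolynomial.eval (fun i => (F i).1 z) p = 0 := fun p hp => by
    have h0 : taylorHom (MvPolynomial.aeval F p) = 0 := by
      have : mk p = 0 := Ideal.Quotient.eq_zero_iff_mem.mpr (hIP hp)
      rw [hT, this, map_zero]
    filter_upwards [eventually_eq_zero_of_taylorHom_eq_zero h0] with z hz
    rwa [← aeval_analyticAtZero_apply]
  refine ⟨fun i => (F i).1, fun i => (F i).2, fun i => ?_, ?_, fun h => hψt ?_⟩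
  · change (F i).1 0 = x₀ i
    rw [← constantCoeff_taylorHom, hF, hψc, hε, MvPolynomial.eval_X]
  -- Finitely many generators give one neighbourhood that serves the whole ideal.
  · obtain ⟨s, hs⟩ := (isNoetherianRing_iff_ideal_fg _).mp inferInstance (idealOf S)
    have := (Filter.eventually_all_finset s).mpr fun p hp =>
      hvan p (hs ▸ Ideal.subset_span hp)
    filter_upwards [this] with z hz
    have hle : idealOf S ≤ RingHom.ker (MvPolynomial.eval fun i => (F i).1 z) := by
      rw [← hs]
      exact Ideal.span_le.mpr hz
    exact fun p hp => hle hp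
  · rw [← hT]
    apply taylorHom_eq_zero_of_eventually
    filter_upwards [h] with z hz
    rwa [aeval_analyticAtZero_apply]

/-! ### Polynomial equations for `W(Λ, d)` -/

theorem zpow_mul_pow_toNat {z : ℂ} (hz : z ≠ 0) (a : ℤ) : z ^ a * z ^ (-a).toNat = z ^ a.toNat := by
  rw [← zpow_natCast, ← zpow_natCast, ← zpow_add₀ hz]
  congr 1
  omega

/-- The defining equation of `V(Λ)` without negative exponents. -/
theorem prod_zpow_eq_iff {n : ℕ} {w : Fin n → ℂ} (hw : w ∈ puncturedSpace n) (a b : Fin n → ℤ)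
    (ζ : ℂ) : (∏ i, w i ^ a i) * (∏ i, (1 - w i) ^ b i) = ζ ↔
      (∏ i, w i ^ (a i).toNat) * (∏ i, (1 - w i) ^ (b i).toNat) =
        ζ * ((∏ i, w i ^ (-a i).toNat) * ∏ i, (1 - w i) ^ (-b i).toNat) := by
  have h1 : ∀ i, 1 - w i ≠ 0 := fun i => sub_ne_zero.mpr (hw i).2.symm
  have hA : ∏ i, w i ^ (a i).toNat = (∏ i, w i ^ a i) * ∏ i, w i ^ (-a i).toNat := by
    rw [← Finset.prod_mul_distrib]
    exact Finset.prod_congr rfl fun i _ => (zpow_mul_pow_toNat (hw i).1 _).symm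
  have hB : ∏ i, (1 - w i) ^ (b i).toNat
      = (∏ i, (1 - w i) ^ b i) * ∏ i, (1 - w i) ^ (-b i).toNat := by
    rw [← Finset.prod_mul_distrib]
    exact Finset.prod_congr rfl fun i _ => (zpow_mul_pow_toNat (h1 i) _).symm
  have hne : (∏ i, w i ^ (-a i).toNat) * ∏ i, (1 - w i) ^ (-b i).toNat ≠ 0 :=
    mul_ne_zero (Finset.prod_ne_zero_iff.mpr fun i _ => pow_ne_zero _ (hw i).1)
      (Finset.prod_ne_zero_iff.mpr fun i _ => pow_ne_zero _ (h1 i))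
  rw [hA, hB, mul_mul_mul_comm, mul_left_inj' hne]

/-- The coordinates of `piMap` as polynomials. -/
noncomputable def piPolynomial {n : ℕ} (d : Fin n → ℕ) (j i : Fin n) : MvPolynomial (Fin n) ℂ :=
  if i = j then MvPolynomial.X j ^ d j else MvPolynomial.X j ^ d i * MvPolynomial.X i

theorem eval_piPolynomial {n : ℕ} (d : Fin n → ℕ) (j i : Fin n) (x : Fin n → ℂ) :
    MvPolynomial.eval x (piPolynomial d j i) = piMap d j x i := by
  unfold piPolynomial piMap
  split_ifs <;> simp

theorem continuous_piMap {n : ℕ} (d : Fin n → ℕ) (j : Fin n) : Continuous (piMap d j) := by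
  refine continuous_pi fun i => ?_
  simpa only [eval_piPolynomial] using MvPolynomial.continuous_eval (piPolynomial d j i)

/-- A point of the Zariski closure of `W(Λ, d)` over `(ℂ \ {0, 1})^n` lies in `W(Λ, d)`. -/
theorem mem_W_of_idealOf {n : ℕ} {Λ : AddSubgroup (Exponent n)} {d : Fin n → ℕ} {j : Fin n}
    {x : Fin n → ℂ} (hx : piMap d j x ∈ puncturedSpace n)
    (h : ∀ p ∈ idealOf (W Λ d j), MvPolynomial.eval x p = 0) : x ∈ W Λ d j := by
  refine ⟨hx, fun a b c hc => ?_⟩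
  rw [prod_zpow_eq_iff hx]
  let π := piPolynomial d j
  let p : MvPolynomial (Fin n) ℂ :=
    (∏ i, π i ^ (a i).toNat) * (∏ i, (1 - π i) ^ (b i).toNat) -
      MvPolynomial.C ((-1 : ℂ) ^ c) *
        ((∏ i, π i ^ (-a i).toNat) * ∏ i, (1 - π i) ^ (-b i).toNat)
  have hp : ∀ y, MvPolynomial.eval y p =
      (∏ i, piMap d j y i ^ (a i).toNat) * (∏ i, (1 - piMap d j y i) ^ (b i).toNat) -
      (-1 : ℂ) ^ c * ((∏ i, piMap d j y i ^ (-a i).toNat) *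
        ∏ i, (1 - piMap d j y i) ^ (-b i).toNat) := fun y => by
    simp [p, π, eval_piPolynomial]
  have hpW : p ∈ idealOf (W Λ d j) := mem_idealOf.mpr fun y hy => by
    rw [hp, sub_eq_zero]
    exact (prod_zpow_eq_iff hy.1 a b _).mp (hy.2 a b c hc)
  have := h p hpW
  rwa [hp, sub_eq_zero] at this

theorem IsDegenerationVector.smul {n : ℕ} {Λ : AddSubgroup (Exponent n)} {d : Fin n → ℕ}
    (hd : IsDegenerationVector Λ d) {m : ℕ} (hm : 0 < m) : IsDegenerationVector Λ (m • d) := by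
  refine ⟨smul_ne_zero hm.ne' hd.1, fun a b c h => ?_⟩
  have := congrArg ((m : ℤ) * ·) (hd.2 a b c h)
  simp only [Finset.mul_sum, mul_zero] at this
  rw [← this]
  refine Finset.sum_congr rfl fun i _ => ?_
  simp
  ring

/-! ### The two implications -/

/-- A function with nonzero value at the origin, continuous there, has a continuous `k`-th root. -/
theorem exists_continuousAt_root {u : ℂ → ℂ} (hu : ContinuousAt u 0) (hu0 : u 0 ≠ 0) {k : ℕ}
    (hk : 0 < k) : ∃ v : ℂ → ℂ, ContinuousAt v 0 ∧ ∀ z, v z ^ k = u z := by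
  -- Normalizing by u(0) puts the base of the principal power near 1, away from the branch cut.
  obtain ⟨c, hc⟩ := IsAlgClosed.exists_pow_nat_eq (u 0) hk
  refine ⟨fun z => c * (u z / u 0) ^ ((k : ℂ)⁻¹), ?_, fun z => ?_⟩
  · refine continuousAt_const.mul ((hu.div_const _).cpow continuousAt_const ?_)
    simp [hu0]
  · rw [mul_pow, hc, Complex.cpow_nat_inv_pow _ hk.ne', mul_div_cancel₀ _ hu0]

theorem Wbar0_nonempty_of_isGenuine {n : ℕ} {Λ : AddSubgroup (Exponent n)} {d : Fin n → ℕ}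
    {j : Fin n} (hj : 0 < d j) (h : IsGenuine Λ d) : (Wbar0 Λ d j).Nonempty := by
  obtain ⟨-, p, hp, f, u, -, -, hf0, hfV, hu, hu0, -, hfu⟩ := h
  have hball : ball (0 : ℂ) 1 ∈ 𝓝 (0 : ℂ) := ball_mem_nhds _ one_pos
  have huc : ∀ i, ContinuousAt (u i) 0 := fun i => ((hu i).differentiableAt hball).continuousAt
  obtain ⟨v, hvc, hv⟩ := exists_continuousAt_root (huc j) (hu0 j) hj
  have hv0 : v 0 ≠ 0 := fun h0 => hu0 j (by rw [← hv, h0, zero_pow hj.ne'])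
  -- The lift through π with t = z v; dividing by v^{d_i} compensates for the change of parameter.
  let x : ℂ → Fin n → ℂ := fun z i => if i = j then z * v z else u i z / v z ^ d i
  have hxc : ContinuousAt x 0 := by
    refine continuousAt_pi.mpr fun i => ?_
    by_cases hi : i = j
    · simp only [x, hi, if_true]
      exact continuousAt_id.mul hvc
    · simp only [x, hi, if_false]
      exact (huc i).div (hvc.pow _) (pow_ne_zero _ hv0)
  have hxf : ∀ z ∈ ball (0 : ℂ) 1, v z ≠ 0 → piMap d j (x z) = f z := by
    intro z hz hvz
    funext i
    rw [hfu z hz]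
    by_cases hi : i = j
    · simp [piMap, x, hi, mul_pow, hv]
    · simp only [piMap, x, hi, if_true, if_false]
      field_simp
      ring
  refine ⟨x 0, ⟨?_, ?_, ?_⟩, by simp [x]⟩
  · refine mem_closure_of_tendsto (b := 𝓝[≠] (0 : ℂ)) (hxc.tendsto.mono_left nhdsWithin_le_nhds) ?_
    filter_upwards [nhdsWithin_le_nhds hball, nhdsWithin_le_nhds (hvc.eventually_ne hv0),
      self_mem_nhdsWithin] with z hz hvz hz0
    change piMap d j (x z) ∈ V Λ
    rw [hxf z hz hvz]
    exact hfV z hz hz0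
  · intro i hi
    simpa [x, hi] using ⟨hu0 i, fun h => absurd h hv0⟩
  · intro i
    rw [hxf 0 (mem_ball_self one_pos) hv0, hf0]
    exact hp.1.2 i

theorem exists_isGenuine_smul {n : ℕ} {Λ : AddSubgroup (Exponent n)} {d : Fin n → ℕ}
    (hd : IsDegenerationVector Λ d) {j : Fin n} (hj : 0 < d j) (h : (Wbar0 Λ d j).Nonempty) :
    ∃ m : ℕ, 0 < m ∧ IsGenuine Λ (m • d) := by
  obtain ⟨x₀, ⟨hx, hU0, hU1⟩, hx0⟩ := h
  have hx0 : x₀ j = 0 := hx0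
  obtain ⟨γ, hγ, hγ0, hγI, hγt⟩ := exists_analytic_curve hx (t := MvPolynomial.X j)
    (fun x hx h => (hx.1 j).1 (by simpa [piMap, hj.ne'] using h)) (by simpa using hx0)
  simp only [MvPolynomial.eval_X] at hγt
  -- `m` is the order of vanishing of t along the curve.
  obtain ⟨m, v, hv, hv0, hγv⟩ :=
    (hγ j).exists_eventuallyEq_pow_smul_nonzero_iff.mpr hγt
  simp only [sub_zero, smul_eq_mul] at hγv
  have hm : 0 < m := by
    rcases Nat.eq_zero_or_pos m with rfl | hm
    · have := hγv.self_of_nhds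
      rw [hγ0, hx0, pow_zero, one_mul] at this
      exact absurd this.symm hv0
    · exact hm
  let Γ : ℂ → Fin n → ℂ := fun z i => γ i z
  have hΓ0 : Γ 0 = x₀ := funext hγ0
  have hπc : ContinuousAt (fun z => piMap d j (Γ z)) 0 :=
    (continuous_piMap d j).continuousAt.comp
      (continuousAt_pi.mpr fun i => (hγ i).continuousAt)
  have hgood : ∀ᶠ z in 𝓝 (0 : ℂ), (∀ i, DifferentiableAt ℂ (γ i) z) ∧ DifferentiableAt ℂ v z ∧
      γ j z = z ^ m * v z ∧ (z ≠ 0 → Γ z ∈ W Λ d j) := by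
    have h1 : ∀ᶠ z in 𝓝 (0 : ℂ), ∀ i, DifferentiableAt ℂ (γ i) z := eventually_all.mpr fun i =>
      (hγ i).eventually_analyticAt.mono fun z hz => hz.differentiableAt
    have h2 : ∀ᶠ z in 𝓝 (0 : ℂ), DifferentiableAt ℂ v z :=
      hv.eventually_analyticAt.mono fun z hz => hz.differentiableAt
    have h3 : ∀ᶠ z in 𝓝 (0 : ℂ), ∀ i, piMap d j (Γ z) i ≠ 1 := eventually_all.mpr fun i =>
      (continuousAt_pi.mp hπc i).eventually_ne (by rw [hΓ0]; exact hU1 i)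
    have h4 : ∀ᶠ z in 𝓝 (0 : ℂ), ∀ i, i ≠ j → γ i z ≠ 0 := eventually_all.mpr fun i => by
      by_cases hi : i = j
      · simp [hi]
      · filter_upwards [(hγ i).continuousAt.eventually_ne
          (by rw [hγ0]; exact hU0 i hi)] with z hz _ using hz
    filter_upwards [h1, h2, h3, h4, hγv, hv.continuousAt.eventually_ne hv0, hγI]
      with z h1 h2 h3 h4 h5 h6 h7
    refine ⟨h1, h2, h5, fun hz => mem_W_of_idealOf (fun i => ⟨?_, h3 i⟩) h7⟩
    have hjz : γ j z ≠ 0 := h5 ▸ mul_ne_zero (pow_ne_zero _ hz) h6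
    by_cases hi : i = j
    · simpa [piMap, hi, Γ] using fun h => absurd h hjz
    · simpa [piMap, hi, Γ] using ⟨fun h => absurd h hjz, h4 i hi⟩
  obtain ⟨r, hr, hball⟩ := Metric.eventually_nhds_iff_ball.mp hgood
  have hr0 : (r : ℂ) ≠ 0 := Complex.ofReal_ne_zero.mpr hr.ne'
  have hscale : ∀ z ∈ ball (0 : ℂ) 1, (r : ℂ) * z ∈ ball (0 : ℂ) r := fun z hz => by
    rw [mem_ball_zero_iff] at hz ⊢
    rw [norm_mul, Complex.norm_real, Real.norm_of_nonneg hr.le]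
    exact mul_lt_of_lt_one_right hr hz
  let f : ℂ → Fin n → ℂ := fun z => piMap d j (Γ (r * z))
  -- Rescaling the disc of radius `r` to the unit disc gives t = z^m (r^m v(rz)); its `d i`-th power
  -- leaves this unit part, times the coordinate u_i when i ≠ j.
  let u : Fin n → ℂ → ℂ := fun i z =>
    (r ^ m * v (r * z)) ^ d i * if i = j then 1 else γ i (r * z)
  have hfu : ∀ z ∈ ball (0 : ℂ) 1, ∀ i, f z i = z ^ (m • d) i * u i z := fun z hz i => by
    have h5 := (hball _ (hscale z hz)).2.2.1
    by_cases hi : i = j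
    · simp only [f, u, Γ, piMap, hi, if_true, h5, Pi.smul_apply, smul_eq_mul]
      ring
    · simp only [f, u, Γ, piMap, hi, if_false, h5, Pi.smul_apply, smul_eq_mul]
      ring
  have hu : ∀ i, DifferentiableOn ℂ (u i) (ball 0 1) := fun i z hz => by
    obtain ⟨h1, h2, -⟩ := hball _ (hscale z hz)
    have hmul : DifferentiableAt ℂ (fun z : ℂ => (r : ℂ) * z) z :=
      (differentiableAt_const _).mul differentiableAt_id
    have hvz : DifferentiableAt ℂ (fun z => v (r * z)) z := DifferentiableAt.comp z h2 hmul
    have hγz : DifferentiableAt ℂ (fun z => γ i (r * z)) z := DifferentiableAt.comp z (h1 i) hmul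
    refine DifferentiableAt.differentiableWithinAt ?_
    refine DifferentiableAt.mul (((differentiableAt_const _).mul hvz).pow _) ?_
    by_cases hi : i = j
    · simp [hi]
    · simpa [hi] using hγz
  have hfd : DifferentiableOn ℂ f (ball 0 1) := differentiableOn_pi.mpr fun i =>
    (((differentiableOn_id.pow _).mul (hu i)).congr fun z hz => hfu z hz i)
  have hfV : ∀ z ∈ ball (0 : ℂ) 1, z ≠ 0 → f z ∈ V Λ := fun z hz hz0 =>
    (hball _ (hscale z hz)).2.2.2 (mul_ne_zero hr0 hz0)
  have hf0 : f 0 = piMap d j x₀ := by simp [f, hΓ0]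
  have hb0 : (0 : ℂ) ∈ ball (0 : ℂ) 1 := mem_ball_self one_pos
  have hnhds : ball (0 : ℂ) 1 ∈ 𝓝 (0 : ℂ) := ball_mem_nhds _ one_pos
  have hp : piMap d j x₀ ∈ Vbar Λ := by
    refine ⟨?_, hU1⟩
    rw [← hf0]
    refine mem_closure_of_tendsto (b := 𝓝[≠] (0 : ℂ))
      ((hfd.differentiableAt hnhds).continuousAt.tendsto.mono_left nhdsWithin_le_nhds) ?_
    filter_upwards [nhdsWithin_le_nhds hnhds, self_mem_nhdsWithin] with z hz hz0
    exact hfV z hz hz0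
  refine ⟨m, hm, hd.smul hm, piMap d j x₀, ⟨hp, fun h => (h.1 j).1 ?_⟩, f, u, hfd, ?_, hf0, hfV,
    hu, fun i => ?_, fun i hi => ?_, hfu⟩
  · simp [piMap, hx0, hj.ne']
  · intro z hz
    by_cases hz0 : z = 0
    · rw [hz0, hf0]
      exact hp
    · have := hfV z hz hz0
      exact ⟨subset_closure this, fun i => (this.1 i).2⟩
  · by_cases hi : i = j
    · simp [u, hi, hr.ne', hv0]
    · have := hU0 i hi
      simp [u, hi, hr.ne', hv0, hγ0, this]
  -- For d_i = 0 the value u_i(0) is the coordinate of `x₀`, which `Ubar` keeps away from 1.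
  · have h0 : d i = 0 := by simpa [hm.ne'] using hi
    have hij : i ≠ j := fun h => hj.ne' (h ▸ h0)
    have := hU1 i
    simpa [u, h0, hij, hγ0, piMap] using this

end GluingVariety

theorem mainTheorem8 {n : ℕ} (Λ : AddSubgroup (GluingVariety.Exponent n))
    (hΛ : Module.finrank ℤ Λ + 1 ≤ n)
    (d : Fin n → ℕ) (hd : GluingVariety.IsDegenerationVector Λ d)
    (j : Fin n) (hj : 0 < d j) :
    (GluingVariety.IsGenuine Λ d → (GluingVariety.Wbar0 Λ d j).Nonempty) ∧
    ((GluingVariety.Wbar0 Λ d j).Nonempty →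
      ∃ m : ℕ, 0 < m ∧ GluingVariety.IsGenuine Λ (m • d)) :=
  ⟨GluingVariety.Wbar0_nonempty_of_isGenuine hj, GluingVariety.exists_isGenuine_smul hd hj⟩
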